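/- Let $(\bar M,\bar g,\bar J)$ be an indefinite Kähler manifold of index $q$, $0<q<\dim\bar M$: $\bar g$ is a semi-Riemannian metric of constant index $q$, $\bar J$ is an almost complex structure with $\bar g(\bar JX,\bar JY)=\bar g(X,Y)$, and $\bar\nabla\bar J=0$ for the Levi-Civita connection $\bar\nabla$ of $\bar g$. Let $M$ be an (immersed) $r$-lightlike submanifold of $\bar M$, i.e. $\mathrm{Rad}(TM)=TM\cap TM^\perp$ has constant rank $r\ge 1$, with a screen distribution $S(TM)$ and a screen transversal bundle $S(TM^\perp)$ (vector subbundles complementary to $\mathrm{Rad}(TM)$ in $TM$ and in $TM^\perp$, respectively), and with a lightlike transversal bundle $ltr(TM)$, i.e. a complement of $\mathrm{Rad}(TM)$ in the orthogonal complement of $S(TM^\perp)$ in $S(TM)^\perp$ which has local smooth frames $N_1,\dots,N_r$ satisfying $\bar g(\xi_i,N_j)=\delta_{ij}$, $\bar g(N_i,N_j)=0$ for some local frame $\xi_1,\dots,\xi_r$ of $\mathrm{Rad}(TM)$. Then $T\bar M|_M=TM\oplus ltr(TM)\oplus S(TM^\perp)$, and for $X,Y\in\Gamma(TM)$ we denote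 by $h^l(X,Y)$ and $h^s(X,Y)$ the components of $\bar\nabla_XY$ in $ltr(TM)$ and in $S(TM^\perp)$. Suppose that $M$ is a screen transversal Cauchy Riemann (STCR) lightlike submanifold: there are vector subbundles $D_1,D_2$ of $\mathrm{Rad}(TM)$, $D_0,D'$ of $S(TM)$, $L_1$ of $ltr(TM)$ and $S$ of $S(TM^\perp)$ such that $$\mathrm{Rad}(TM)=D_1\oplus D_2,\quad \bar J(D_1)\subset S(TM),\quad \bar J(D_2)\subset S(TM^\perp),$$ $$S(TM)=\{\bar J(D_1)\oplus D'\}\perp D_0,\quad \bar J(D_0)=D_0,\quad \bar J(D')=L_1\perp S,$$ with $D_0$ non-degenerate (here $\perp$ denotes an orthogonal direct sum). Put $D=D_0\oplus D_1\oplus\bar J(D_1)\subset TM$, and let $L_2$ be a vector subbundle of $ltr(TM)$ with $ltr(TM)=L_1\oplus L_2$ (for instance the one with $\bar J(L_2)\subset S(TM^\perp)$, when it exists). Then $D$ is integrable, i.e. $[X,Y]\in\Gamma(D)$ for all $X,Y\in\Gamma(D)$, if and only if for all $X,Y\in\Gamma(D)$ $$h^s(X,\bar JY)-h^s(Y,\bar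 JX)\in\Gamma(\bar J(L_2))\quad\text{and}\quad h^l(X,\bar JY)-h^l(Y,\bar JX)\in\Gamma(L_2).$$ -/

import Mathlib

open Bundle Set
open scoped Manifold ContDiff

noncomputable section

namespace STCR

section LinearAlgebra

variable {V : Type*} [AddCommGroup V] [Module ℝ V] [FiniteDimensional ℝ V]

/-- The linear algebra behind the splitting of the ambient tangent space along a lightlike
submanifold: `T` is the tangent space, `A` the screen, `C` the co-screen and `L` the lightlike
transversal space. -/
theorem lightlike_splitting (B : LinearMap.BilinForm ℝ V) (hs : ∀ u v, B u v = B v u)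
    (hnd : ∀ u, (∀ v, B u v = 0) → u = 0)
    (T A C L : Submodule ℝ V)
    (hA : A ⊔ (T ⊓ B.orthogonal T) = T) (hA' : Disjoint A (T ⊓ B.orthogonal T))
    (hC : C ⊔ (T ⊓ B.orthogonal T) = B.orthogonal T)
    (hC' : Disjoint C (T ⊓ B.orthogonal T))
    (hL : (T ⊓ B.orthogonal T) ⊔ L = B.orthogonal A ⊓ B.orthogonal C)
    (hL' : ∀ u ∈ L, (∀ v ∈ T ⊓ B.orthogonal T, B v u = 0) → u = 0) :
    IsCompl L (T ⊔ C) ∧ IsCompl C (T ⊔ L) := by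
  have hrefl : B.IsRefl := fun u v h => by rw [hs]; exact h
  have hB : B.Nondegenerate :=
    ⟨fun u h => hnd u h, fun u h => hnd u fun v => by rw [hs]; exact h v⟩
  have hoo : B.orthogonal (B.orthogonal T) = T :=
    LinearMap.BilinForm.orthogonal_orthogonal hB hrefl T
  have hAT : A ≤ T := hA ▸ le_sup_left
  have hCT : C ≤ B.orthogonal T := hC ▸ le_sup_left
  have orth : ∀ {F : Submodule ℝ V} {m : V}, m ∈ B.orthogonal F ↔ ∀ n ∈ F, B n m = 0 :=
    fun {F m} => Iff.rfl
  have hAd : Disjoint A (B.orthogonal A) := by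
    rw [Submodule.disjoint_def]
    intro a ha ha'
    refine (Submodule.disjoint_def.1 hA') a ha ⟨hAT ha, orth.2 fun t ht => ?_⟩
    rw [← hA] at ht
    obtain ⟨x, hx, y, hy, rfl⟩ := Submodule.mem_sup.1 ht
    have h1 : B x a = 0 := ha' x hx
    have h2 : B y a = 0 := by rw [hs]; exact hy.2 a (hAT ha)
    simp [h1, h2]
  have hCd : Disjoint C (B.orthogonal C) := by
    rw [Submodule.disjoint_def]
    intro c hc hc'
    refine (Submodule.disjoint_def.1 hC') c hc ⟨?_, hCT hc⟩
    rw [← hoo]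
    refine orth.2 fun t ht => ?_
    rw [← hC] at ht
    obtain ⟨x, hx, y, hy, rfl⟩ := Submodule.mem_sup.1 ht
    have h1 : B x c = 0 := hc' x hx
    have h2 : B y c = 0 := hCT hc y hy.1
    simp [h1, h2]
  have hAc := (LinearMap.BilinForm.isCompl_orthogonal_iff_disjoint hrefl).2 hAd
  have hCc := (LinearMap.BilinForm.isCompl_orthogonal_iff_disjoint hrefl).2 hCd
  have htop : ∀ v : V, ∃ t ∈ T, ∃ c ∈ C, ∃ l ∈ L, v = t + c + l := by
    intro v
    have hv : v ∈ A ⊔ B.orthogonal A := by rw [hAc.sup_eq_top]; trivial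
    obtain ⟨a, ha, v', hv', rfl⟩ := Submodule.mem_sup.1 hv
    have hv2 : v' ∈ C ⊔ B.orthogonal C := by rw [hCc.sup_eq_top]; trivial
    obtain ⟨c, hc, w, hw, rfl⟩ := Submodule.mem_sup.1 hv2
    have hw' : w ∈ (T ⊓ B.orthogonal T) ⊔ L := by
      rw [hL]
      refine ⟨orth.2 fun x hx => ?_, hw⟩
      have h1 : B x (c + w) = 0 := hv' x hx
      have h2 : B x c = 0 := hCT hc x (hAT hx)
      simpa [h2] using h1
    obtain ⟨ρ, hρ, l, hl, rfl⟩ := Submodule.mem_sup.1 hw'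
    exact ⟨a + ρ, T.add_mem (hAT ha) hρ.1, c, hc, l, hl, by abel⟩
  have hLz : ∀ l ∈ L, ∀ t ∈ T, ∀ c ∈ C, l = t + c → l = 0 := by
    intro l hl t ht c hc h
    refine hL' l hl fun v hv => ?_
    have h1 : B v t = 0 := by rw [hs]; exact hv.2 t ht
    have h2 : B v c = 0 := hCT hc v hv.1
    rw [h]
    simp [h1, h2]
  constructor
  · refine ⟨Submodule.disjoint_def.2 fun l hl hl' => ?_, codisjoint_iff.2 (eq_top_iff.2 ?_)⟩
    · obtain ⟨t, ht, c, hc, h⟩ := Submodule.mem_sup.1 hl'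
      exact hLz l hl t ht c hc h.symm
    · intro v _
      obtain ⟨t, ht, c, hc, l, hl, rfl⟩ := htop v
      exact Submodule.mem_sup.2 ⟨l, hl, t + c,
        Submodule.add_mem_sup ht hc, by abel⟩
  · refine ⟨Submodule.disjoint_def.2 fun c hc hc' => ?_, codisjoint_iff.2 (eq_top_iff.2 ?_)⟩
    · obtain ⟨t, ht, l, hl, h⟩ := Submodule.mem_sup.1 hc'
      have hl0 : l = 0 := hLz l hl (-t) (T.neg_mem ht) c hc (by rw [← h]; abel)
      subst hl0
      rw [add_zero] at h
      subst h
      exact (Submodule.disjoint_def.1 hC') t hc ⟨ht, hCT hc⟩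
    · intro v _
      obtain ⟨t, ht, c, hc, l, hl, rfl⟩ := htop v
      exact Submodule.mem_sup.2 ⟨c, hc, t + l, Submodule.add_mem_sup ht hl, by abel⟩

end LinearAlgebra

section Ambient

variable (E' : Type*) [NormedAddCommGroup E'] [NormedSpace ℝ E'] [FiniteDimensional ℝ E']
  (N : Type*) [TopologicalSpace N] [ChartedSpace E' N] [IsManifold 𝓘(ℝ, E') ∞ N]

/-- A (smooth) semi-Riemannian metric: a smooth family of symmetric nondegenerate bilinear forms
on the tangent spaces. -/
structure SemiRiemannianMetric where
  val : Π x : N, TangentSpace 𝓘(ℝ, E') x →L[ℝ] TangentSpace 𝓘(ℝ, E') x →L[ℝ] ℝ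
  symm : ∀ (x : N) (u v : TangentSpace 𝓘(ℝ, E') x), val x u v = val x v u
  nondegenerate : ∀ (x : N) (u : TangentSpace 𝓘(ℝ, E') x), (∀ v, val x u v = 0) → u = 0
  contMDiff : ContMDiff 𝓘(ℝ, E') (𝓘(ℝ, E').prod 𝓘(ℝ, E' →L[ℝ] E' →L[ℝ] ℝ)) ∞
    (fun x => TotalSpace.mk' (E' →L[ℝ] E' →L[ℝ] ℝ)
      (E := fun x : N => TangentSpace 𝓘(ℝ, E') x →L[ℝ] TangentSpace 𝓘(ℝ, E') x →L[ℝ] ℝ)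
      x (val x))

variable {E' N}

/-- The bilinear form of the metric on the tangent space at `x`. -/
def SemiRiemannianMetric.form (g : SemiRiemannianMetric E' N) (x : N) :
    LinearMap.BilinForm ℝ (TangentSpace 𝓘(ℝ, E') x) :=
  (g.val x).toBilinForm

/-- The metric has constant index `q`: the maximal dimension of a subspace of any tangent space on
which it is negative definite is `q`. -/
def SemiRiemannianMetric.HasIndex (g : SemiRiemannianMetric E' N) (q : ℕ) : Prop :=
  ∀ x : N, sigNeg (LinearMap.BilinMap.toQuadraticMap (g.form x)) = q

/-- `∇` is the Levi-Civita connection of `g`: it is torsion-free and metric. -/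
structure IsLeviCivita (g : SemiRiemannianMetric E' N)
    (nabla : CovariantDerivative 𝓘(ℝ, E') E' (TangentSpace 𝓘(ℝ, E') : N → Type _)) : Prop where
  torsion_free : ∀ (X Y : Π x : N, TangentSpace 𝓘(ℝ, E') x) (x : N),
    MDiffAt (T% X) x → MDiffAt (T% Y) x →
      nabla Y x (X x) - nabla X x (Y x) = VectorField.mlieBracket 𝓘(ℝ, E') X Y x
  metric : ∀ (Y Z : Π x : N, TangentSpace 𝓘(ℝ, E') x) (x : N) (v : TangentSpace 𝓘(ℝ, E') x),
    MDiffAt (T% Y) x → MDiffAt (T% Z) x →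
      mvfderiv 𝓘(ℝ, E') (fun y => g.val y (Y y) (Z y)) x v
        = g.val x (nabla Y x v) (Z x) + g.val x (Y x) (nabla Z x v)

variable (E' N) in
/-- An indefinite Kähler structure of index `q` on `N`. -/
structure IndefiniteKahler (q : ℕ) where
  g : SemiRiemannianMetric E' N
  hasIndex : g.HasIndex q
  index_pos : 0 < q
  index_lt : q < Module.finrank ℝ E'
  J : Π x : N, TangentSpace 𝓘(ℝ, E') x →L[ℝ] TangentSpace 𝓘(ℝ, E') x
  J_contMDiff : ContMDiff 𝓘(ℝ, E') (𝓘(ℝ, E').prod 𝓘(ℝ, E' →L[ℝ] E')) ∞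
    (fun x => TotalSpace.mk' (E' →L[ℝ] E')
      (E := fun x : N => TangentSpace 𝓘(ℝ, E') x →L[ℝ] TangentSpace 𝓘(ℝ, E') x) x (J x))
  J_sq : ∀ (x : N) (u : TangentSpace 𝓘(ℝ, E') x), J x (J x u) = -u
  hermitian : ∀ (x : N) (u v : TangentSpace 𝓘(ℝ, E') x),
    g.val x (J x u) (J x v) = g.val x u v
  nabla : CovariantDerivative 𝓘(ℝ, E') E' (TangentSpace 𝓘(ℝ, E') : N → Type _)
  leviCivita : IsLeviCivita g nabla
  J_parallel : ∀ (Y : Π x : N, TangentSpace 𝓘(ℝ, E') x) (x : N) (v : TangentSpace 𝓘(ℝ, E') x),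
    MDiffAt (T% Y) x → nabla (fun y => J y (Y y)) x v - J x (nabla Y x v) = 0

end Ambient

section Submanifold

variable {E' : Type*} [NormedAddCommGroup E'] [NormedSpace ℝ E'] [FiniteDimensional ℝ E']
  {N : Type*} [TopologicalSpace N] [ChartedSpace E' N] [IsManifold 𝓘(ℝ, E') ∞ N]
  {E : Type*} [NormedAddCommGroup E] [NormedSpace ℝ E]
  {M : Type*} [TopologicalSpace M] [ChartedSpace E M]

/-- A smooth immersion `f : M → N`; `M` is regarded as a submanifold of `N` through `f`, and
`T_p M` as the subspace `df_p(T_p M)` of `T_{f p} N`. -/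
structure IsImmersedSubmanifold (f : M → N) : Prop where
  contMDiff : ContMDiff 𝓘(ℝ, E) 𝓘(ℝ, E') ∞ f
  injective_mfderiv : ∀ p : M, Function.Injective (mfderiv 𝓘(ℝ, E) 𝓘(ℝ, E') f p)

/-- The tangent space of the submanifold as a subspace of the ambient tangent space. -/
def tangent (f : M → N) (p : M) : Submodule ℝ (TangentSpace 𝓘(ℝ, E') (f p)) :=
  LinearMap.range (mfderiv 𝓘(ℝ, E) 𝓘(ℝ, E') f p).toLinearMap

/-- The fibre at `p` of the normal bundle `TM^⊥`. -/
def normal (g : SemiRiemannianMetric E' N) (f : M → N) (p : M) :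
    Submodule ℝ (TangentSpace 𝓘(ℝ, E') (f p)) :=
  (g.form (f p)).orthogonal (tangent (E := E) f p)

/-- The fibre at `p` of the radical distribution `Rad TM = TM ∩ TM^⊥`. -/
def radical (g : SemiRiemannianMetric E' N) (f : M → N) (p : M) :
    Submodule ℝ (TangentSpace 𝓘(ℝ, E') (f p)) :=
  tangent (E := E) f p ⊓ normal (E := E) g f p

/-- Smoothness on `U` of a section of the ambient tangent bundle along `f`. -/
def SmoothAlongOn (f : M → N) (s : Π p : M, TangentSpace 𝓘(ℝ, E') (f p)) (U : Set M) : Prop :=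
  ContMDiffOn 𝓘(ℝ, E) 𝓘(ℝ, E').tangent ∞
    (fun p => (⟨f p, s p⟩ : TangentBundle 𝓘(ℝ, E') N)) U

/-- A family of subspaces of the spaces `T_{f p} N` is a smooth vector subbundle of `TN|_M`:
locally it has a smooth frame. -/
def IsSubbundle (f : M → N) (F : Π p : M, Submodule ℝ (TangentSpace 𝓘(ℝ, E') (f p))) : Prop :=
  ∀ p₀ : M, ∃ U : Set M, IsOpen U ∧ p₀ ∈ U ∧ ∃ (k : ℕ)
    (s : Fin k → Π p : M, TangentSpace 𝓘(ℝ, E') (f p)),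
    (∀ i, SmoothAlongOn (E := E) f (s i) U) ∧
    ∀ p ∈ U, LinearIndependent ℝ (fun i => s i p) ∧
      Submodule.span ℝ (range fun i => s i p) = F p

/-- An `r`-lightlike submanifold `(M, g, S(TM), S(TM^⊥))` together with a lightlike transversal
bundle `ltr(TM)`. -/
structure LightlikeSubmanifold (g : SemiRiemannianMetric E' N) (f : M → N) (r : ℕ) where
  immersed : IsImmersedSubmanifold (E := E) (E' := E') f
  one_le : 1 ≤ r
  finrank_radical : ∀ p, Module.finrank ℝ (radical (E := E) g f p) = r
  /-- The screen distribution `S(TM)`. -/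
  screen : Π p : M, Submodule ℝ (TangentSpace 𝓘(ℝ, E') (f p))
  screen_subbundle : IsSubbundle (E := E) f screen
  screen_disjoint : ∀ p, Disjoint (screen p) (radical (E := E) g f p)
  screen_sup : ∀ p, screen p ⊔ radical (E := E) g f p = tangent (E := E) f p
  /-- The screen transversal bundle `S(TM^⊥)`. -/
  coscreen : Π p : M, Submodule ℝ (TangentSpace 𝓘(ℝ, E') (f p))
  coscreen_subbundle : IsSubbundle (E := E) f coscreen
  coscreen_disjoint : ∀ p, Disjoint (coscreen p) (radical (E := E) g f p)
  coscreen_sup : ∀ p, coscreen p ⊔ radical (E := E) g f p = normal (E := E) g f p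
  /-- The lightlike transversal bundle `ltr(TM)`. -/
  ltr : Π p : M, Submodule ℝ (TangentSpace 𝓘(ℝ, E') (f p))
  /-- `ltr(TM)` is a complement of `Rad TM` in the orthogonal complement of `S(TM^⊥)` in
  `S(TM)^⊥`. -/
  ltr_disjoint : ∀ p, Disjoint (radical (E := E) g f p) (ltr p)
  ltr_sup : ∀ p, radical (E := E) g f p ⊔ ltr p
    = (g.form (f p)).orthogonal (screen p) ⊓ (g.form (f p)).orthogonal (coscreen p)
  /-- Locally there are smooth frames `ξ` of `Rad TM` and `ν` of `ltr(TM)` with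
  `g(ξ i, ν j) = δ i j` and `g(ν i, ν j) = 0`. -/
  ltr_frame : ∀ p₀ : M, ∃ U : Set M, IsOpen U ∧ p₀ ∈ U ∧
    ∃ ξ ν : Fin r → Π p : M, TangentSpace 𝓘(ℝ, E') (f p),
      (∀ i, SmoothAlongOn (E := E) f (ξ i) U) ∧ (∀ i, SmoothAlongOn (E := E) f (ν i) U) ∧
      ∀ p ∈ U,
        Submodule.span ℝ (range fun i => ξ i p) = radical (E := E) g f p ∧
        Submodule.span ℝ (range fun i => ν i p) = ltr p ∧
        (∀ i j, g.val (f p) (ξ i p) (ν j p) = if i = j then 1 else 0) ∧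
        (∀ i j, g.val (f p) (ν i p) (ν j p) = 0)

namespace LightlikeSubmanifold

variable {g : SemiRiemannianMetric E' N} {f : M → N} {r : ℕ}

/-- The splitting `TN|_M = TM ⊕ ltr(TM) ⊕ S(TM^⊥)`. -/
theorem splitting (S : LightlikeSubmanifold (E := E) g f r) (p : M) :
    IsCompl (S.ltr p) (tangent (E := E) f p ⊔ S.coscreen p) ∧
      IsCompl (S.coscreen p) (tangent (E := E) f p ⊔ S.ltr p) := by
  have : FiniteDimensional ℝ (TangentSpace 𝓘(ℝ, E') (f p)) :=
    inferInstanceAs (FiniteDimensional ℝ E')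
  refine lightlike_splitting (g.form (f p)) (g.symm (f p)) (g.nondegenerate (f p))
    (tangent (E := E) f p) (S.screen p) (S.coscreen p) (S.ltr p) (S.screen_sup p)
    (S.screen_disjoint p) (S.coscreen_sup p) (S.coscreen_disjoint p) (S.ltr_sup p) ?_
  intro u hu h
  obtain ⟨U, -, hpU, ξ, ν, -, -, hfr⟩ := S.ltr_frame p
  obtain ⟨hξ, hν, hd, -⟩ := hfr p hpU
  rw [← hν] at hu
  obtain ⟨c, rfl⟩ := (Submodule.mem_span_range_iff_exists_fun ℝ).1 hu
  refine Finset.sum_eq_zero fun j _ => ?_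
  have hj : g.val (f p) (ξ j p) (∑ i, c i • ν i p) = 0 :=
    h (ξ j p) (hξ ▸ Submodule.subset_span ⟨j, rfl⟩ : ξ j p ∈ radical (E := E) g f p)
  have hc : c j = 0 := by simpa [hd] using hj
  simp [hc]

/-- The component in `ltr(TM)` of a vector in `T_{f p} N = T_p M ⊕ ltr(TM)_p ⊕ S(TM^⊥)_p`. -/
def ltrPart (S : LightlikeSubmanifold (E := E) g f r) (p : M) :
    TangentSpace 𝓘(ℝ, E') (f p) →ₗ[ℝ] TangentSpace 𝓘(ℝ, E') (f p) :=
  (S.ltr p).projection (tangent (E := E) f p ⊔ S.coscreen p) (S.splitting p).1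

/-- The component in `S(TM^⊥)` of a vector in `T_{f p} N = T_p M ⊕ ltr(TM)_p ⊕ S(TM^⊥)_p`. -/
def coscreenPart (S : LightlikeSubmanifold (E := E) g f r) (p : M) :
    TangentSpace 𝓘(ℝ, E') (f p) →ₗ[ℝ] TangentSpace 𝓘(ℝ, E') (f p) :=
  (S.coscreen p).projection (tangent (E := E) f p ⊔ S.ltr p) (S.splitting p).2

end LightlikeSubmanifold

/-- The covariant derivative `∇_v V` at `p` of a section `V` of `TN` along `f : M → N`, in the
direction `v ∈ T_p M` (i.e. the pull-back connection): if `V = ∑ Vⁱ (e_i ∘ f)` in the local frame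
`e_i` of `TN` given by the chart at `f p`, then
`∇_v V = ∑ (dVⁱ(v) e_i(f p) + Vⁱ(p) ∇_{df(v)} e_i)`. -/
def covAlong (nabla : CovariantDerivative 𝓘(ℝ, E') E' (TangentSpace 𝓘(ℝ, E') : N → Type _))
    (f : M → N) (V : Π p : M, TangentSpace 𝓘(ℝ, E') (f p)) (p : M)
    (v : TangentSpace 𝓘(ℝ, E) p) : TangentSpace 𝓘(ℝ, E') (f p) :=
  let e := trivializationAt E' (TangentSpace 𝓘(ℝ, E') : N → Type _) (f p)
  let b := Module.finBasis ℝ E'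
  ∑ i, (mvfderiv 𝓘(ℝ, E) (fun x : M => e.localFrameCoeff 𝓘(ℝ, E') b i (f x) (V x)) p v
          • e.localFrame b i (f p)
      + e.localFrameCoeff 𝓘(ℝ, E') b i (f p) (V p)
          • nabla (e.localFrame b i) (f p) (mfderiv 𝓘(ℝ, E) 𝓘(ℝ, E') f p v))

variable {q : ℕ}

/-- The image `J(F)` of a family of subspaces along `f`. -/
def JImage (K : IndefiniteKahler E' N q) (f : M → N)
    (F : Π p : M, Submodule ℝ (TangentSpace 𝓘(ℝ, E') (f p))) (p : M) :
    Submodule ℝ (TangentSpace 𝓘(ℝ, E') (f p)) :=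
  (F p).map (K.J (f p)).toLinearMap

/-- The lightlike second fundamental form `h^l(X, V)`, the `ltr(TM)`-part of `∇_X V`, for a vector
field `X` on `M` and a field `V` along `f` (tangent to `M` in the intended use). -/
def hl (K : IndefiniteKahler E' N q) {f : M → N} {r : ℕ}
    (S : LightlikeSubmanifold (E := E) K.g f r) (X : Π p : M, TangentSpace 𝓘(ℝ, E) p)
    (V : Π p : M, TangentSpace 𝓘(ℝ, E') (f p)) (p : M) : TangentSpace 𝓘(ℝ, E') (f p) :=
  S.ltrPart p (covAlong K.nabla f V p (X p))

/-- The screen second fundamental form `h^s(X, V)`, the `S(TM^⊥)`-part of `∇_X V`, for a vector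
field `X` on `M` and a field `V` along `f` (tangent to `M` in the intended use). -/
def hs (K : IndefiniteKahler E' N q) {f : M → N} {r : ℕ}
    (S : LightlikeSubmanifold (E := E) K.g f r) (X : Π p : M, TangentSpace 𝓘(ℝ, E) p)
    (V : Π p : M, TangentSpace 𝓘(ℝ, E') (f p)) (p : M) : TangentSpace 𝓘(ℝ, E') (f p) :=
  S.coscreenPart p (covAlong K.nabla f V p (X p))

/-- The field `J Y` along `f`, for a vector field `Y` on `M`. -/
def JField (K : IndefiniteKahler E' N q) (f : M → N) (Y : Π p : M, TangentSpace 𝓘(ℝ, E) p)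
    (p : M) : TangentSpace 𝓘(ℝ, E') (f p) :=
  K.J (f p) (mfderiv 𝓘(ℝ, E) 𝓘(ℝ, E') f p (Y p))

/-- The subspaces `F` and `G` are `g`-orthogonal. -/
def Orth (g : SemiRiemannianMetric E' N) (x : N)
    (F G : Submodule ℝ (TangentSpace 𝓘(ℝ, E') x)) : Prop :=
  ∀ u ∈ F, ∀ v ∈ G, g.val x u v = 0

/-- The bundles making a lightlike submanifold a screen transversal Cauchy Riemann (STCR)
lightlike submanifold. -/
structure STCRStructure (K : IndefiniteKahler E' N q) {f : M → N} {r : ℕ}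
    (S : LightlikeSubmanifold (E := E) K.g f r) where
  D₁ : Π p : M, Submodule ℝ (TangentSpace 𝓘(ℝ, E') (f p))
  D₂ : Π p : M, Submodule ℝ (TangentSpace 𝓘(ℝ, E') (f p))
  D₀ : Π p : M, Submodule ℝ (TangentSpace 𝓘(ℝ, E') (f p))
  D' : Π p : M, Submodule ℝ (TangentSpace 𝓘(ℝ, E') (f p))
  L₁ : Π p : M, Submodule ℝ (TangentSpace 𝓘(ℝ, E') (f p))
  S₀ : Π p : M, Submodule ℝ (TangentSpace 𝓘(ℝ, E') (f p))
  D₁_subbundle : IsSubbundle (E := E) f D₁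
  D₂_subbundle : IsSubbundle (E := E) f D₂
  D₀_subbundle : IsSubbundle (E := E) f D₀
  D'_subbundle : IsSubbundle (E := E) f D'
  L₁_subbundle : IsSubbundle (E := E) f L₁
  S₀_subbundle : IsSubbundle (E := E) f S₀
  /-- `Rad TM = D₁ ⊕ D₂`. -/
  D₁_D₂_disjoint : ∀ p, Disjoint (D₁ p) (D₂ p)
  D₁_D₂_sup : ∀ p, D₁ p ⊔ D₂ p = radical (E := E) K.g f p
  JD₁_le : ∀ p, JImage K f D₁ p ≤ S.screen p
  JD₂_le : ∀ p, JImage K f D₂ p ≤ S.coscreen p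
  /-- `S(TM) = (J D₁ ⊕ D') ⊥ D₀`. -/
  JD₁_D'_disjoint : ∀ p, Disjoint (JImage K f D₁ p) (D' p)
  JD₁_D'_D₀_disjoint : ∀ p, Disjoint (JImage K f D₁ p ⊔ D' p) (D₀ p)
  JD₁_D'_D₀_orth : ∀ p, Orth K.g (f p) (JImage K f D₁ p ⊔ D' p) (D₀ p)
  JD₁_D'_D₀_sup : ∀ p, (JImage K f D₁ p ⊔ D' p) ⊔ D₀ p = S.screen p
  JD₀_eq : ∀ p, JImage K f D₀ p = D₀ p
  /-- `J D' = L₁ ⊥ S₀`, where `L₁ ⊆ ltr(TM)` and `S₀ ⊆ S(TM^⊥)`. -/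
  L₁_S₀_disjoint : ∀ p, Disjoint (L₁ p) (S₀ p)
  L₁_S₀_orth : ∀ p, Orth K.g (f p) (L₁ p) (S₀ p)
  JD'_eq : ∀ p, JImage K f D' p = L₁ p ⊔ S₀ p
  L₁_le : ∀ p, L₁ p ≤ S.ltr p
  S₀_le : ∀ p, S₀ p ≤ S.coscreen p
  /-- `D₀` is nondegenerate. -/
  D₀_nondegenerate : ∀ p, ∀ u ∈ D₀ p, (∀ v ∈ D₀ p, K.g.val (f p) u v = 0) → u = 0

/-- The distribution `D = D₀ ⊕ D₁ ⊕ J D₁`, as a family of subspaces of `TM`. -/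
def STCRStructure.D {K : IndefiniteKahler E' N q} {f : M → N} {r : ℕ}
    {S : LightlikeSubmanifold (E := E) K.g f r} (C : STCRStructure K S) (p : M) :
    Submodule ℝ (TangentSpace 𝓘(ℝ, E') (f p)) :=
  C.D₀ p ⊔ C.D₁ p ⊔ JImage K f C.D₁ p

/-- `X ∈ Γ(F)`: `X` is a smooth vector field on `M` with values in the distribution `F`. -/
def IsSectionOf [IsManifold 𝓘(ℝ, E) ∞ M] (f : M → N) (F : Π p : M, Submodule ℝ (TangentSpace 𝓘(ℝ, E') (f p)))
    (X : Π p : M, TangentSpace 𝓘(ℝ, E) p) : Prop :=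
  ContMDiff 𝓘(ℝ, E) 𝓘(ℝ, E).tangent ∞ (fun p => (⟨p, X p⟩ : TangentBundle 𝓘(ℝ, E) M)) ∧
    ∀ p, mfderiv 𝓘(ℝ, E) 𝓘(ℝ, E') f p (X p) ∈ F p

/-- The distribution `F` on `M` is integrable: `[X, Y] ∈ Γ(F)` for all `X, Y ∈ Γ(F)`. -/
def IsIntegrable [IsManifold 𝓘(ℝ, E) ∞ M] (f : M → N)
    (F : Π p : M, Submodule ℝ (TangentSpace 𝓘(ℝ, E') (f p))) : Prop :=
  ∀ X Y : Π p : M, TangentSpace 𝓘(ℝ, E) p,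
    IsSectionOf f F X → IsSectionOf f F Y →
      IsSectionOf f F (VectorField.mlieBracket 𝓘(ℝ, E) X Y)

end Submanifold

end STCR

end

/-! Since the connection is torsion-free and `J` is parallel, `∇_X JY - ∇_Y JX = J[X, Y]` along `M`.
The two conditions therefore concern only the `S(TM^⊥)`- and `ltr(TM)`-parts of `J w`, for the
tangent vector `w = [X, Y]`, and the theorem reduces to a pointwise statement
(`mem_iff_projection_mem`): `w` lies in `D` iff these parts lie in `J L₂` and `L₂`.

If `w` is in `D`, then `J w` is in `D`, hence tangent, and both parts vanish. Conversely, write `w =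
d + d' + d₂` along `TM = D + D' + D₂`, with `J d' = l + s`, `l` in `L₁`, `s` in `S₀`. The `ltr`-part
of `J w` is `l`, which lies in `L₁ ∩ L₂ = 0`. The screen transversal part is then `s + J d₂ = J(d' +
d₂)`. As `J` is injective, `d' + d₂` lies in `L₂`; it is also tangent, so it is zero and `w = d`.
The space `J L₂` need not lie in `S(TM^⊥)`.

The analytic work is the displayed identity (`covAlong_JField_sub`). As `covAlong` is defined by
components in a chart, `covAlong_J` and `covAlong_torsion_free` are proved there, from a Leibniz
rule for arbitrary finite expansions (`covAlong_sum_smul`) and the formula `dF[X, Y] = X(Y F) - Y(X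
F)` (`mvfderiv_mlieBracket`). -/

namespace STCR

open VectorField Filter Topology

/-! ### The Lie bracket as a commutator of derivations. -/

section Bracket

variable {E : Type*} [NormedAddCommGroup E] [NormedSpace ℝ E]
  {M : Type*} [TopologicalSpace M] [ChartedSpace E M]
  {G : Type*} [NormedAddCommGroup G] [NormedSpace ℝ G]

/-- In a normed space, the derivative of `F` sends the Lie bracket of two vector fields to the
antisymmetrised iterated directional derivative of `F`. -/
theorem fderiv_lieBracket {F : E → G} {X Y : E → E} {y : E} (hF : ContDiffAt ℝ 2 F y)
    (hX : DifferentiableAt ℝ X y) (hY : DifferentiableAt ℝ Y y) :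
    fderiv ℝ F y (lieBracket ℝ X Y y) =
      fderiv ℝ (fun z => fderiv ℝ F z (Y z)) y (X y)
        - fderiv ℝ (fun z => fderiv ℝ F z (X z)) y (Y y) := by
  have hF' : DifferentiableAt ℝ (fderiv ℝ F) y :=
    (hF.fderiv_right (m := 1) (by norm_num)).differentiableAt (by norm_num)
  -- Each iterated derivative is a second-derivative term plus `DF` of the derivative of a field.
  -- The second-derivative terms cancel by symmetry.
  have hsymm : IsSymmSndFDerivAt ℝ F y := hF.isSymmSndFDerivAt (by simp)
  rw [fderiv_clm_apply hF' hY, fderiv_clm_apply hF' hX]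
  simp [lieBracket, hsymm.eq (X y) (Y y)]

/-- The representative of a vector field in the chart at `p`. -/
noncomputable def chartRep (p : M) (X : Π x : M, TangentSpace 𝓘(ℝ, E) x) : E → E :=
  mpullbackWithin 𝓘(ℝ, E) 𝓘(ℝ, E) (extChartAt 𝓘(ℝ, E) p).symm X (range 𝓘(ℝ, E))

/-- The directional derivative of a function along a vector field, read in the chart at `p`. -/
theorem fderiv_comp_extChartAt_symm_apply [IsManifold 𝓘(ℝ, E) 1 M] {F : M → G} {p : M}
    (Y : Π x : M, TangentSpace 𝓘(ℝ, E) x) {y : E} (hy : y ∈ (extChartAt 𝓘(ℝ, E) p).target)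
    (hF : MDifferentiableAt 𝓘(ℝ, E) 𝓘(ℝ, G) F ((extChartAt 𝓘(ℝ, E) p).symm y)) :
    fderiv ℝ (F ∘ (extChartAt 𝓘(ℝ, E) p).symm) y (chartRep p Y y) =
      mvfderiv 𝓘(ℝ, E) F ((extChartAt 𝓘(ℝ, E) p).symm y)
        (Y ((extChartAt 𝓘(ℝ, E) p).symm y)) := by
  have hinv := isInvertible_mfderivWithin_extChartAt_symm hy
  have hψ := mdifferentiableWithinAt_extChartAt_symm hy
  rw [chartRep, mpullbackWithin_apply]
  simp only [modelWithCornersSelf_coe, range_id, mfderivWithin_univ,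
    mdifferentiableWithinAt_univ] at hinv hψ ⊢
  -- `chartRep` applies the inverse of the differential of the inverse chart, which cancels against
  -- the chain rule factor.
  rw [← mfderiv_eq_fderiv, mfderiv_comp y hF hψ]
  exact congrArg (mvfderiv 𝓘(ℝ, E) F ((extChartAt 𝓘(ℝ, E) p).symm y))
    (hinv.self_apply_inverse (Y ((extChartAt 𝓘(ℝ, E) p).symm y)))

/-- The directional derivative of a function along a vector field factors through the chart. -/
theorem mvfderiv_apply_eq_chart [IsManifold 𝓘(ℝ, E) 1 M] {F : M → G} {p x : M}
    (hx : MDifferentiableAt 𝓘(ℝ, E) 𝓘(ℝ, G) F x) (hxs : x ∈ (extChartAt 𝓘(ℝ, E) p).source)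
    (Y : Π x : M, TangentSpace 𝓘(ℝ, E) x) :
    mvfderiv 𝓘(ℝ, E) F x (Y x) =
      fderiv ℝ (F ∘ (extChartAt 𝓘(ℝ, E) p).symm) (extChartAt 𝓘(ℝ, E) p x)
        (chartRep p Y (extChartAt 𝓘(ℝ, E) p x)) := by
  have hl := (extChartAt 𝓘(ℝ, E) p).left_inv hxs
  have h := fderiv_comp_extChartAt_symm_apply (F := F) Y
    ((extChartAt 𝓘(ℝ, E) p).map_source hxs) (by rwa [hl])
  refine Eq.trans ?_ h.symm
  exact congrArg (fun x => mvfderiv 𝓘(ℝ, E) F x (Y x)) hl.symm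

/-- The representative of a vector field in the chart at `p`, at the point `p`. -/
theorem chartRep_extChartAt_self [IsManifold 𝓘(ℝ, E) 1 M]
    (X : Π x : M, TangentSpace 𝓘(ℝ, E) x) (p : M) :
    chartRep p X (extChartAt 𝓘(ℝ, E) p p) = mvfderiv 𝓘(ℝ, E) (extChartAt 𝓘(ℝ, E) p) p (X p) := by
  rw [mvfderiv_apply_eq_chart (mdifferentiableAt_extChartAt (mem_chart_source E p))
    (mem_extChartAt_source p) X]
  have hid : extChartAt 𝓘(ℝ, E) p ∘ (extChartAt 𝓘(ℝ, E) p).symm =ᶠ[𝓝 (extChartAt 𝓘(ℝ, E) p p)]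
      id := by
    filter_upwards [extChartAt_target_mem_nhds (I := 𝓘(ℝ, E)) p] with y hy
    exact (extChartAt 𝓘(ℝ, E) p).right_inv hy
  rw [hid.fderiv_eq, fderiv_id]
  rfl

/-- The bracket on `M` at `p` is defined as the pull-back, under the chart at `p`, of the bracket of
the representatives; the differential of the chart undoes this pull-back. -/
theorem chartRep_mlieBracket [IsManifold 𝓘(ℝ, E) 1 M]
    (X Y : Π x : M, TangentSpace 𝓘(ℝ, E) x) (p : M) :
    chartRep p (mlieBracket 𝓘(ℝ, E) X Y) (extChartAt 𝓘(ℝ, E) p p) =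
      lieBracket ℝ (chartRep p X) (chartRep p Y) (extChartAt 𝓘(ℝ, E) p p) := by
  have hs : (extChartAt 𝓘(ℝ, E) p).symm ⁻¹' univ ∩ range 𝓘(ℝ, E) = univ := by simp
  rw [chartRep_extChartAt_self, ← lieBracketWithin_univ, ← hs]
  let w : E := lieBracketWithin ℝ (chartRep p X) (chartRep p Y)
    ((extChartAt 𝓘(ℝ, E) p).symm ⁻¹' univ ∩ range 𝓘(ℝ, E)) (extChartAt 𝓘(ℝ, E) p p)
  exact (isInvertible_mfderiv_extChartAt (I := 𝓘(ℝ, E))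
    (mem_extChartAt_source p)).self_apply_inverse w

theorem contDiffAt_comp_extChartAt_symm [IsManifold 𝓘(ℝ, E) 2 M] {F : M → G} {p : M}
    (hF : ContMDiffAt 𝓘(ℝ, E) 𝓘(ℝ, G) 2 F p) :
    ContDiffAt ℝ 2 (F ∘ (extChartAt 𝓘(ℝ, E) p).symm) (extChartAt 𝓘(ℝ, E) p p) := by
  rw [← contMDiffAt_iff_contDiffAt]
  have h := contMDiffWithinAt_extChartAt_symm_range (I := 𝓘(ℝ, E)) (n := 2) p
    (mem_extChartAt_target p)
  simp only [modelWithCornersSelf_coe, range_id, contMDiffWithinAt_univ] at h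
  exact ContMDiffAt.comp_of_eq hF h (extChartAt_to_inv p)

theorem differentiableAt_chartRep [CompleteSpace E]
    [IsManifold 𝓘(ℝ, E) 2 M] {X : Π x : M, TangentSpace 𝓘(ℝ, E) x} {p : M}
    (hX : MDiffAt (T% X) p) :
    DifferentiableAt ℝ (chartRep p X) (extChartAt 𝓘(ℝ, E) p p) := by
  have h := MDifferentiableWithinAt.differentiableWithinAt_mpullbackWithin_vectorField
    (s := univ) (mdifferentiableWithinAt_univ.2 hX)
  unfold chartRep
  simp only [modelWithCornersSelf_coe, range_id, preimage_univ, inter_univ] at h ⊢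
  exact differentiableWithinAt_univ.1 h

/-- The derivative of the directional derivative of `F` along a vector field, in the chart. -/
theorem hasMFDerivAt_mvfderiv_apply [CompleteSpace E] [IsManifold 𝓘(ℝ, E) 2 M] {F : M → G}
    {X : Π x : M, TangentSpace 𝓘(ℝ, E) x} {p : M} (hF : ContMDiffAt 𝓘(ℝ, E) 𝓘(ℝ, G) 2 F p)
    (hX : MDiffAt (T% X) p) :
    HasMFDerivAt 𝓘(ℝ, E) 𝓘(ℝ, G) (fun x => mvfderiv 𝓘(ℝ, E) F x (X x)) p
      ((fderiv ℝ (fun y => fderiv ℝ (F ∘ (extChartAt 𝓘(ℝ, E) p).symm) y (chartRep p X y))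
        (extChartAt 𝓘(ℝ, E) p p)).comp (mvfderiv 𝓘(ℝ, E) (extChartAt 𝓘(ℝ, E) p) p)) := by
  -- The chart formula for the derivative must hold near `p`, so `F` has to be differentiable on a
  -- neighbourhood.
  obtain ⟨u, hu, hFu⟩ := (contMDiffAt_iff_contMDiffOn_nhds (by simp)).1 hF
  have hG : DifferentiableAt ℝ (fderiv ℝ (F ∘ (extChartAt 𝓘(ℝ, E) p).symm))
      (extChartAt 𝓘(ℝ, E) p p) :=
    ((contDiffAt_comp_extChartAt_symm hF).fderiv_right (m := 1) (by norm_num)).differentiableAt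
      (by norm_num)
  have h := hG.clm_apply (differentiableAt_chartRep hX)
  have hφ := (mdifferentiableAt_extChartAt (I := 𝓘(ℝ, E))
    (mem_chart_source E p)).hasMFDerivAt
  refine (h.hasFDerivAt.hasMFDerivAt.comp p hφ).congr_of_eventuallyEq ?_
  filter_upwards [eventually_eventually_nhds.2 hu,
    extChartAt_source_mem_nhds (I := 𝓘(ℝ, E)) p] with x hx hxs
  exact mvfderiv_apply_eq_chart ((hFu.contMDiffAt hx).mdifferentiableAt (by simp)) hxs X

/-- The derivative of a vector-valued function `F` sends the Lie bracket of two vector fields to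
the antisymmetrised iterated directional derivative of `F`. -/
theorem mvfderiv_mlieBracket [CompleteSpace E] [IsManifold 𝓘(ℝ, E) 2 M] {F : M → G}
    {X Y : Π x : M, TangentSpace 𝓘(ℝ, E) x} {p : M} (hF : ContMDiffAt 𝓘(ℝ, E) 𝓘(ℝ, G) 2 F p)
    (hX : MDiffAt (T% X) p) (hY : MDiffAt (T% Y) p) :
    mvfderiv 𝓘(ℝ, E) F p (mlieBracket 𝓘(ℝ, E) X Y p) =
      mvfderiv 𝓘(ℝ, E) (fun x => mvfderiv 𝓘(ℝ, E) F x (Y x)) p (X p)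
        - mvfderiv 𝓘(ℝ, E) (fun x => mvfderiv 𝓘(ℝ, E) F x (X x)) p (Y p) := by
  have hv : ∀ {Z W : Π x : M, TangentSpace 𝓘(ℝ, E) x}, MDiffAt (T% Z) p →
      mvfderiv 𝓘(ℝ, E) (fun x => mvfderiv 𝓘(ℝ, E) F x (Z x)) p (W p) =
        fderiv ℝ (fun y => fderiv ℝ (F ∘ (extChartAt 𝓘(ℝ, E) p).symm) y (chartRep p Z y))
          (extChartAt 𝓘(ℝ, E) p p) (chartRep p W (extChartAt 𝓘(ℝ, E) p p)) := by
    intro Z W hZ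
    rw [chartRep_extChartAt_self]
    exact congrArg (fun A : E →L[ℝ] G => A (W p)) (hasMFDerivAt_mvfderiv_apply hF hZ).mfderiv
  rw [hv hX, hv hY, mvfderiv_apply_eq_chart (hF.mdifferentiableAt (by simp))
    (mem_extChartAt_source p), chartRep_mlieBracket,
    fderiv_lieBracket (contDiffAt_comp_extChartAt_symm hF) (differentiableAt_chartRep hX)
      (differentiableAt_chartRep hY)]

end Bracket

/-! ### Coordinate fields and coordinate components. -/

section Frame

variable {E' : Type*} [NormedAddCommGroup E'] [NormedSpace ℝ E'] [FiniteDimensional ℝ E']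
  {N : Type*} [TopologicalSpace N] [ChartedSpace E' N] [IsManifold 𝓘(ℝ, E') ∞ N]

/-- The coordinate vector field `∂ᵢ` of the chart at `y₀`. -/
noncomputable abbrev coordField (y₀ : N) (i : Fin (Module.finrank ℝ E')) :
    Π y : N, TangentSpace 𝓘(ℝ, E') y :=
  (trivializationAt E' (TangentSpace 𝓘(ℝ, E') : N → Type _) y₀).localFrame
    (Module.finBasis ℝ E') i

/-- The `i`-th component of tangent vectors in the frame of coordinate fields of the chart at
`y₀`. -/
noncomputable abbrev coordCoeff (y₀ : N) (i : Fin (Module.finrank ℝ E')) (y : N) :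
    TangentSpace 𝓘(ℝ, E') y →ₗ[ℝ] ℝ :=
  (trivializationAt E' (TangentSpace 𝓘(ℝ, E') : N → Type _) y₀).localFrameCoeff 𝓘(ℝ, E')
    (Module.finBasis ℝ E') i y

/-- The `i`-th coordinate function of the chart at `y₀`. -/
noncomputable def coordFun (y₀ : N) (i : Fin (Module.finrank ℝ E')) (y : N) : ℝ :=
  (Module.finBasis ℝ E').equivFunL (extChartAt 𝓘(ℝ, E') y₀ y) i

theorem coordCoeff_eq_repr {y₀ y : N} (hy : y ∈ (chartAt E' y₀).source)
    (i : Fin (Module.finrank ℝ E')) (v : TangentSpace 𝓘(ℝ, E') y) :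
    coordCoeff y₀ i y v = (Module.finBasis ℝ E').repr
      ((trivializationAt E' (TangentSpace 𝓘(ℝ, E') : N → Type _) y₀) ⟨y, v⟩).2 i := by
  classical
  -- The frame lemma concerns sections, so `v` is extended by zero to a section with value `v` at
  -- `y`.
  have h := Trivialization.localFrameCoeff_eq_coeff (I := 𝓘(ℝ, E'))
    (trivializationAt E' (TangentSpace 𝓘(ℝ, E') : N → Type _) y₀)
    (b := Module.finBasis ℝ E') (s := Function.update 0 y v) (i := i) (x := y)
    (by simpa using hy)
  simpa using h

theorem sum_coordCoeff_smul {y₀ y : N} (hy : y ∈ (chartAt E' y₀).source)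
    (v : TangentSpace 𝓘(ℝ, E') y) :
    ∑ i, coordCoeff y₀ i y v • coordField y₀ i y = v := by
  classical
  have h := Trivialization.eq_sum_localFrameCoeff_smul (I := 𝓘(ℝ, E'))
    (e := trivializationAt E' (TangentSpace 𝓘(ℝ, E') : N → Type _) y₀)
    (b := Module.finBasis ℝ E') (s := Function.update 0 y v) (x' := y)
    (by simpa using hy)
  simpa using h.symm

theorem coordCoeff_coordField {y₀ y : N} (hy : y ∈ (chartAt E' y₀).source)
    (i j : Fin (Module.finrank ℝ E')) :
    coordCoeff y₀ i y (coordField y₀ j y) = if j = i then 1 else 0 := by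
  have hy' : y ∈ (trivializationAt E' (TangentSpace 𝓘(ℝ, E') : N → Type _) y₀).baseSet := by
    simpa using hy
  rw [Trivialization.localFrameCoeff_apply_of_mem_baseSet _ _ hy', coordField,
    Trivialization.localFrame_apply_of_mem_baseSet _ _ hy']
  simp [Finsupp.single_apply]

theorem contMDiffAt_coordField {y₀ y : N} (hy : y ∈ (chartAt E' y₀).source)
    (i : Fin (Module.finrank ℝ E')) :
    ContMDiffAt 𝓘(ℝ, E') 𝓘(ℝ, E').tangent ∞ (T% (coordField y₀ i)) y :=
  contMDiffAt_localFrame_of_mem ∞ _ _ i (by simpa using hy)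

theorem mdifferentiableAt_coordField {y₀ y : N} (hy : y ∈ (chartAt E' y₀).source)
    (i : Fin (Module.finrank ℝ E')) : MDiffAt (T% (coordField y₀ i)) y :=
  (contMDiffAt_coordField hy i).mdifferentiableAt (by simp)

theorem contMDiffAt_coordFun {y₀ y : N} (hy : y ∈ (chartAt E' y₀).source)
    (i : Fin (Module.finrank ℝ E')) :
    ContMDiffAt 𝓘(ℝ, E') 𝓘(ℝ, ℝ) ∞ (coordFun y₀ i) y := by
  have h : ContMDiffAt 𝓘(ℝ, E') 𝓘(ℝ, E') ∞ (extChartAt 𝓘(ℝ, E') y₀) y := contMDiffAt_extChartAt' hy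
  exact ContMDiffAt.comp y
    (((ContinuousLinearMap.proj (R := ℝ) (φ := fun _ => ℝ) i).comp
      (Module.finBasis ℝ E').equivFunL.toContinuousLinearMap).contMDiff.contMDiffAt) h

/-- The tangent trivialization of a chart is its differential, so components are the values of
`dxⁱ`. This makes the scalar bracket formula applicable to components. -/
theorem coordCoeff_eq_mvfderiv {y₀ y : N} (hy : y ∈ (chartAt E' y₀).source)
    (i : Fin (Module.finrank ℝ E')) (v : TangentSpace 𝓘(ℝ, E') y) :
    coordCoeff y₀ i y v = mvfderiv 𝓘(ℝ, E') (coordFun y₀ i) y v := by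
  rw [coordCoeff_eq_repr hy]
  have h : MDifferentiableAt 𝓘(ℝ, E') 𝓘(ℝ, E') (extChartAt 𝓘(ℝ, E') y₀) y :=
    mdifferentiableAt_extChartAt hy
  have hL := ((ContinuousLinearMap.proj (R := ℝ) (φ := fun _ => ℝ) i).comp
      (Module.finBasis ℝ E').equivFunL.toContinuousLinearMap).hasMFDerivAt
        (x := extChartAt 𝓘(ℝ, E') y₀ y)
  have hd := (hL.comp y h.hasMFDerivAt).mfderiv
  have hT := TangentBundle.continuousLinearMapAt_trivializationAt (I := 𝓘(ℝ, E')) hy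
  have hv : ((trivializationAt E' (TangentSpace 𝓘(ℝ, E') : N → Type _) y₀) ⟨y, v⟩).2 =
      mvfderiv 𝓘(ℝ, E') (extChartAt 𝓘(ℝ, E') y₀) y v := by
    refine Eq.trans ?_ (congrArg (fun A : TangentSpace 𝓘(ℝ, E') y →L[ℝ] E' => A v) hT)
    have hy' : y ∈ (trivializationAt E' (TangentSpace 𝓘(ℝ, E') : N → Type _) y₀).baseSet := by
      simpa using hy
    exact (congrFun (Trivialization.coe_linearMapAt_of_mem (R := ℝ)
      (trivializationAt E' (TangentSpace 𝓘(ℝ, E') : N → Type _) y₀) hy') v).symm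
  rw [hv]
  exact (congrArg (fun A : E' →L[ℝ] ℝ => A v) hd).symm

/-- Each component is `dxᵏ[∂ᵢ, ∂ⱼ] = ∂ᵢ(δⱼₖ) - ∂ⱼ(δᵢₖ)`, a difference of derivatives of constants.
-/
theorem mlieBracket_coordField {y₀ y : N} (hy : y ∈ (chartAt E' y₀).source)
    (i j : Fin (Module.finrank ℝ E')) :
    mlieBracket 𝓘(ℝ, E') (coordField y₀ i) (coordField y₀ j) y = 0 := by
  have : CompleteSpace E' := FiniteDimensional.complete ℝ E'
  have hc : ∀ k l : Fin (Module.finrank ℝ E'),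
      (fun z => mvfderiv 𝓘(ℝ, E') (coordFun y₀ k) z (coordField y₀ l z)) =ᶠ[𝓝 y]
        fun _ => if l = k then (1 : ℝ) else 0 := by
    intro k l
    filter_upwards [(chartAt E' y₀).open_source.mem_nhds hy] with z hz
    rw [← coordCoeff_eq_mvfderiv hz, coordCoeff_coordField hz]
  have hd : ∀ k l : Fin (Module.finrank ℝ E'), mvfderiv 𝓘(ℝ, E')
      (fun z => mvfderiv 𝓘(ℝ, E') (coordFun y₀ k) z (coordField y₀ l z)) y = 0 := by
    intro k l
    rw [← mvfderiv_const (I := 𝓘(ℝ, E')) (if l = k then (1 : ℝ) else 0) (x := y)]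
    exact (hc k l).mfderiv_eq
  rw [← sum_coordCoeff_smul hy (mlieBracket 𝓘(ℝ, E') (coordField y₀ i) (coordField y₀ j) y)]
  refine Finset.sum_eq_zero fun k _ => ?_
  rw [coordCoeff_eq_mvfderiv hy, mvfderiv_mlieBracket ((contMDiffAt_coordFun hy k).of_le (by norm_cast))
    (mdifferentiableAt_coordField hy i) (mdifferentiableAt_coordField hy j), hd, hd]
  simp only [zero_apply, sub_zero, zero_smul]

end Frame

/-! ### Leibniz rules for the connection and for its pull-back. -/

section Connection

variable {E' : Type*} [NormedAddCommGroup E'] [NormedSpace ℝ E']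
  {N : Type*} [TopologicalSpace N] [ChartedSpace E' N] [IsManifold 𝓘(ℝ, E') ∞ N]
  {E : Type*} [NormedAddCommGroup E] [NormedSpace ℝ E]
  {M : Type*} [TopologicalSpace M] [ChartedSpace E M]
  {nabla : CovariantDerivative 𝓘(ℝ, E') E' (TangentSpace 𝓘(ℝ, E') : N → Type _)}

theorem mvfderiv_sum_apply {ι : Type*} (s : Finset ι) {a : ι → M → ℝ} {p : M}
    (ha : ∀ i, MDifferentiableAt 𝓘(ℝ, E) 𝓘(ℝ, ℝ) (a i) p) (v : TangentSpace 𝓘(ℝ, E) p) :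
    mvfderiv 𝓘(ℝ, E) (fun x => ∑ i ∈ s, a i x) p v = ∑ i ∈ s, mvfderiv 𝓘(ℝ, E) (a i) p v := by
  classical
  have hd : ∀ s : Finset ι, MDifferentiableAt 𝓘(ℝ, E) 𝓘(ℝ, ℝ) (fun x => ∑ i ∈ s, a i x) p := by
    intro s
    induction s using Finset.induction_on with
    | empty => simpa using mdifferentiableAt_const
    | insert j s hj ih =>
      simp only [Finset.sum_insert hj]
      exact (ha j).add ih
  induction s using Finset.induction_on with
  | empty => simpa using congrArg (fun A => A v) (mvfderiv_const (I := 𝓘(ℝ, E)) (0 : ℝ) (x := p))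
  | insert j s hj ih =>
    rw [Finset.sum_insert hj, ← ih]
    have h := congrArg (fun A => A v) (mvfderiv_add (ha j) (hd s))
    simp only [Finset.sum_insert hj]
    exact h

theorem mvfderiv_mul_apply {a c : M → ℝ} {p : M}
    (ha : MDifferentiableAt 𝓘(ℝ, E) 𝓘(ℝ, ℝ) a p) (hc : MDifferentiableAt 𝓘(ℝ, E) 𝓘(ℝ, ℝ) c p)
    (v : TangentSpace 𝓘(ℝ, E) p) :
    mvfderiv 𝓘(ℝ, E) (fun x => a x * c x) p v =
      mvfderiv 𝓘(ℝ, E) a p v * c p + a p * mvfderiv 𝓘(ℝ, E) c p v := by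
  have h := congrArg (fun A => A v) (mvfderiv_mul ha hc)
  refine Eq.trans h ?_
  simp
  ring

theorem mvfderiv_congr {G : Type*} [NormedAddCommGroup G] [NormedSpace ℝ G] {a c : M → G} {p : M}
    (h : a =ᶠ[𝓝 p] c) (v : TangentSpace 𝓘(ℝ, E) p) :
    mvfderiv 𝓘(ℝ, E) a p v = mvfderiv 𝓘(ℝ, E) c p v :=
  congrArg (fun A : E →L[ℝ] G => A v) h.mfderiv_eq

theorem nabla_sum_smul {ι : Type*} (s : Finset ι) {a : ι → N → ℝ}
    {W : ι → Π y : N, TangentSpace 𝓘(ℝ, E') y} {y : N}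
    (ha : ∀ i, MDifferentiableAt 𝓘(ℝ, E') 𝓘(ℝ, ℝ) (a i) y) (hW : ∀ i, MDiffAt (T% (W i)) y)
    (w : TangentSpace 𝓘(ℝ, E') y) :
    nabla (fun z => ∑ i ∈ s, a i z • W i z) y w =
      ∑ i ∈ s, (mvfderiv 𝓘(ℝ, E') (a i) y w • W i y + a i y • nabla (W i) y w) := by
  classical
  induction s using Finset.induction_on with
  | empty =>
    have h := nabla.isCovariantDerivativeOn.zero (x := y)
    simp only [Finset.sum_empty]
    exact congrArg (fun A => A w) h
  | insert j s hj ih =>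
    have h1 : MDiffAt (T% (a j • W j)) y := (ha j).smul_section (hW j)
    have h2 : MDiffAt (T% (fun z => ∑ i ∈ s, a i z • W i z)) y :=
      MDifferentiableAt.sum_section fun i _ => (ha i).smul_section (hW i)
    have h := nabla.isCovariantDerivativeOn.add h1 h2
    have hl := nabla.isCovariantDerivativeOn.leibniz (hW j) (ha j)
    rw [Finset.sum_insert hj, ← ih]
    have he : (fun z => ∑ i ∈ insert j s, a i z • W i z) =
        (a j • W j) + fun z => ∑ i ∈ s, a i z • W i z := by
      funext z
      simp [Finset.sum_insert hj]
    rw [he, h, hl]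
    simp only [add_apply, ContinuousLinearMap.smulRight_apply, smul_apply]
    abel

variable [FiniteDimensional ℝ E']

theorem mdifferentiableAt_coordCoeff {W : Π y : N, TangentSpace 𝓘(ℝ, E') y} {y₀ y : N}
    (hy : y ∈ (chartAt E' y₀).source) (hW : MDiffAt (T% W) y)
    (i : Fin (Module.finrank ℝ E')) :
    MDifferentiableAt 𝓘(ℝ, E') 𝓘(ℝ, ℝ) (fun z => coordCoeff y₀ i z (W z)) y :=
  mdifferentiableAt_localFrameCoeff _ (by simpa using hy) hW i

/-- The connection is local, so `W` may be replaced by its expansion in the frame. The result has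
the shape of the definition of `covAlong`. -/
theorem nabla_eq_sum {W : Π y : N, TangentSpace 𝓘(ℝ, E') y} {y₀ y : N}
    (hy : y ∈ (chartAt E' y₀).source) (hW : MDiffAt (T% W) y) (w : TangentSpace 𝓘(ℝ, E') y) :
    nabla W y w = ∑ i, (mvfderiv 𝓘(ℝ, E') (fun z => coordCoeff y₀ i z (W z)) y w •
      coordField y₀ i y + coordCoeff y₀ i y (W y) • nabla (coordField y₀ i) y w) := by
  have ha := fun i => mdifferentiableAt_coordCoeff hy hW i
  have he := fun i => mdifferentiableAt_coordField (E' := E') hy i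
  rw [← nabla_sum_smul Finset.univ ha he w]
  have h2 : MDiffAt (T% (fun z => ∑ i, coordCoeff y₀ i z (W z) • coordField y₀ i z)) y :=
    MDifferentiableAt.sum_section fun i _ => (ha i).smul_section (he i)
  have h := nabla.isCovariantDerivativeOn.congr_of_eventuallyEq hW h2 univ_mem (by
    filter_upwards [(chartAt E' y₀).open_source.mem_nhds hy] with z hz
    exact (sum_coordCoeff_smul hz (W z)).symm)
  exact congrArg (fun A => A w) h

theorem covAlong_def (f : M → N) (V : Π p : M, TangentSpace 𝓘(ℝ, E') (f p)) (p : M)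
    (v : TangentSpace 𝓘(ℝ, E) p) :
    covAlong nabla f V p v =
      ∑ i, (mvfderiv 𝓘(ℝ, E) (fun x => coordCoeff (f p) i (f x) (V x)) p v •
          coordField (f p) i (f p) +
        coordCoeff (f p) i (f p) (V p) •
          nabla (coordField (f p) i) (f p) (mfderiv 𝓘(ℝ, E) 𝓘(ℝ, E') f p v)) := rfl

/-- The Leibniz and chain rules for the covariant derivative along `f`. -/
theorem covAlong_sum_smul {ι : Type*} (s : Finset ι) {f : M → N} {p : M}
    (hf : MDifferentiableAt 𝓘(ℝ, E) 𝓘(ℝ, E') f p)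
    {V : Π x : M, TangentSpace 𝓘(ℝ, E') (f x)} {a : ι → M → ℝ}
    {W : ι → Π y : N, TangentSpace 𝓘(ℝ, E') y}
    (ha : ∀ j, MDifferentiableAt 𝓘(ℝ, E) 𝓘(ℝ, ℝ) (a j) p)
    (hW : ∀ j, MDiffAt (T% (W j)) (f p))
    (hV : ∀ᶠ x in 𝓝 p, V x = ∑ j ∈ s, a j x • W j (f x)) (v : TangentSpace 𝓘(ℝ, E) p) :
    covAlong nabla f V p v =
      ∑ j ∈ s, (mvfderiv 𝓘(ℝ, E) (a j) p v • W j (f p) +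
        a j p • nabla (W j) (f p) (mfderiv 𝓘(ℝ, E) 𝓘(ℝ, E') f p v)) := by
  have hy : f p ∈ (chartAt E' (f p)).source := mem_chart_source E' (f p)
  have hc : ∀ i j, MDifferentiableAt 𝓘(ℝ, E) 𝓘(ℝ, ℝ)
      (fun x => coordCoeff (f p) i (f x) (W j (f x))) p := fun i j =>
    (mdifferentiableAt_coordCoeff hy (hW j) i).comp p hf
  have hd : ∀ i, mvfderiv 𝓘(ℝ, E) (fun x => coordCoeff (f p) i (f x) (V x)) p v =
      ∑ j ∈ s, (mvfderiv 𝓘(ℝ, E) (a j) p v * coordCoeff (f p) i (f p) (W j (f p)) +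
        a j p * mvfderiv 𝓘(ℝ, E') (fun z => coordCoeff (f p) i z (W j z)) (f p)
          (mfderiv 𝓘(ℝ, E) 𝓘(ℝ, E') f p v)) := by
    intro i
    have h1 : (fun x => coordCoeff (f p) i (f x) (V x)) =ᶠ[𝓝 p]
        fun x => ∑ j ∈ s, a j x * coordCoeff (f p) i (f x) (W j (f x)) := by
      filter_upwards [hV] with x hx
      simp [hx]
    rw [mvfderiv_congr h1]
    refine (mvfderiv_sum_apply s (fun j => (ha j).mul (hc i j)) v).trans ?_
    refine Finset.sum_congr rfl fun j _ => ?_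
    refine (mvfderiv_mul_apply (ha j) (hc i j) v).trans ?_
    congr 2
    exact mvfderiv_comp_apply p (mdifferentiableAt_coordCoeff hy (hW j) i) hf v
  rw [covAlong_def]
  -- Expanding `W j` and its covariant derivative in the coordinate frame leaves two double sums
  -- that differ in the order of summation.
  have hj : ∀ j, mvfderiv 𝓘(ℝ, E) (a j) p v • W j (f p) +
        a j p • nabla (W j) (f p) (mfderiv 𝓘(ℝ, E) 𝓘(ℝ, E') f p v) =
      ∑ i, ((mvfderiv 𝓘(ℝ, E) (a j) p v * coordCoeff (f p) i (f p) (W j (f p)) +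
        a j p * mvfderiv 𝓘(ℝ, E') (fun z => coordCoeff (f p) i z (W j z)) (f p)
          (mfderiv 𝓘(ℝ, E) 𝓘(ℝ, E') f p v)) • coordField (f p) i (f p) +
        (a j p * coordCoeff (f p) i (f p) (W j (f p))) •
          nabla (coordField (f p) i) (f p) (mfderiv 𝓘(ℝ, E) 𝓘(ℝ, E') f p v)) := by
    intro j
    conv_lhs => rw [nabla_eq_sum hy (hW j), ← sum_coordCoeff_smul hy (W j (f p))]
    rw [Finset.smul_sum, Finset.smul_sum, ← Finset.sum_add_distrib]
    refine Finset.sum_congr rfl fun i _ => ?_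
    -- The expansion also replaced `W j (f p)` inside the coefficients; this restores it there.
    rw [sum_coordCoeff_smul hy (W j (f p))]
    module
  rw [Finset.sum_congr rfl fun j _ => hj j, Finset.sum_comm]
  refine Finset.sum_congr rfl fun i _ => ?_
  rw [hd i, Finset.sum_add_distrib (f := fun j => _ • coordField (f p) i (f p)),
    ← Finset.sum_smul, ← Finset.sum_smul, hV.self_of_nhds]
  simp

/-- The components of a differentiable field along `f` are differentiable. -/
theorem mdifferentiableAt_coordCoeff_along {f : M → N} {p : M}
    {V : Π x : M, TangentSpace 𝓘(ℝ, E') (f x)}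
    (hV : MDifferentiableAt 𝓘(ℝ, E) 𝓘(ℝ, E').tangent
      (fun x => (⟨f x, V x⟩ : TangentBundle 𝓘(ℝ, E') N)) p) (i : Fin (Module.finrank ℝ E')) :
    MDifferentiableAt 𝓘(ℝ, E) 𝓘(ℝ, ℝ) (fun x => coordCoeff (f p) i (f x) (V x)) p := by
  obtain ⟨hf, hV'⟩ := (mdifferentiableAt_totalSpace _ _).1 hV
  have hL := ((ContinuousLinearMap.proj (R := ℝ) (φ := fun _ => ℝ) i).comp
      (Module.finBasis ℝ E').equivFunL.toContinuousLinearMap).mdifferentiableAt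
        (x := ((trivializationAt E' (TangentSpace 𝓘(ℝ, E') : N → Type _) (f p)) ⟨f p, V p⟩).2)
  refine (hL.comp p hV').congr_of_eventuallyEq ?_
  filter_upwards [hf.continuousAt.preimage_mem_nhds
    ((chartAt E' (f p)).open_source.mem_nhds (mem_chart_source E' (f p)))] with x hx
  exact coordCoeff_eq_repr hx i (V x)

end Connection

/-! ### Parallelism of `J` and vanishing torsion along `f`. -/

section Submanifold

theorem eventually_mem_chart_source {E' N M : Type*} [TopologicalSpace E'] [TopologicalSpace N]
    [ChartedSpace E' N] [TopologicalSpace M] {f : M → N} {p : M} (hf : ContinuousAt f p) :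
    ∀ᶠ x in 𝓝 p, f x ∈ (chartAt E' (f p)).source :=
  hf.preimage_mem_nhds ((chartAt E' (f p)).open_source.mem_nhds (mem_chart_source E' (f p)))

variable {E' : Type*} [NormedAddCommGroup E'] [NormedSpace ℝ E']
  {N : Type*} [TopologicalSpace N] [ChartedSpace E' N] [IsManifold 𝓘(ℝ, E') ∞ N]
  {E : Type*} [NormedAddCommGroup E] [NormedSpace ℝ E]
  {M : Type*} [TopologicalSpace M] [ChartedSpace E M]

/-- The image under `df` of a vector field, as a field along `f`. -/
theorem mdifferentiableAt_mfderiv_apply [IsManifold 𝓘(ℝ, E) ∞ M] {f : M → N} (hf : ContMDiff 𝓘(ℝ, E) 𝓘(ℝ, E') ∞ f)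
    {X : Π x : M, TangentSpace 𝓘(ℝ, E) x} {p : M} (hX : MDiffAt (T% X) p) :
    MDifferentiableAt 𝓘(ℝ, E) 𝓘(ℝ, E').tangent
      (fun x => (⟨f x, mfderiv 𝓘(ℝ, E) 𝓘(ℝ, E') f x (X x)⟩ : TangentBundle 𝓘(ℝ, E') N)) p := by
  have h : ContMDiff 𝓘(ℝ, E).tangent 𝓘(ℝ, E').tangent ∞ (tangentMap 𝓘(ℝ, E) 𝓘(ℝ, E') f) :=
    hf.contMDiff_tangentMap le_rfl
  exact (h.mdifferentiable (by simp) _).comp p hX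

variable [FiniteDimensional ℝ E']

/-- A parallel almost complex structure commutes with the covariant derivative along `f`. -/
theorem covAlong_J {q : ℕ} (K : IndefiniteKahler E' N q) {f : M → N} {p : M}
    (hf : MDifferentiableAt 𝓘(ℝ, E) 𝓘(ℝ, E') f p)
    {V : Π x : M, TangentSpace 𝓘(ℝ, E') (f x)}
    (hV : MDifferentiableAt 𝓘(ℝ, E) 𝓘(ℝ, E').tangent
      (fun x => (⟨f x, V x⟩ : TangentBundle 𝓘(ℝ, E') N)) p) (v : TangentSpace 𝓘(ℝ, E) p) :
    covAlong K.nabla f (fun x => K.J (f x) (V x)) p v = K.J (f p) (covAlong K.nabla f V p v) := by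
  have hy : f p ∈ (chartAt E' (f p)).source := mem_chart_source E' (f p)
  have he := fun i => mdifferentiableAt_coordField (E' := E') hy i
  have hJ := fun i => MDifferentiableAt.clm_bundle_apply
    (K.J_contMDiff.mdifferentiable (by simp) (f p)) (he i)
  -- By linearity `JV` has the components of `V` in the fields `J∂ᵢ`, whose covariant derivatives
  -- are `J∇∂ᵢ`.
  have hsum : ∀ᶠ x in 𝓝 p, K.J (f x) (V x) =
      ∑ i, coordCoeff (f p) i (f x) (V x) • K.J (f x) (coordField (f p) i (f x)) := by
    filter_upwards [eventually_mem_chart_source (E' := E') hf.continuousAt] with x hx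
    conv_lhs => rw [← sum_coordCoeff_smul hx (V x)]
    simp
  rw [covAlong_sum_smul Finset.univ (V := fun x => K.J (f x) (V x)) hf
    (W := fun i y => K.J y (coordField (f p) i y))
    (fun i => mdifferentiableAt_coordCoeff_along hV i) hJ hsum, covAlong_def, map_sum]
  refine Finset.sum_congr rfl fun i _ => ?_
  rw [map_add, map_smul, map_smul,
    sub_eq_zero.1 (K.J_parallel (coordField (f p) i) (f p) _ (he i))]

variable [IsManifold 𝓘(ℝ, E) ∞ M]

/-- The pull-back along `f` of a torsion-free connection is torsion-free. -/
theorem covAlong_torsion_free [CompleteSpace E] {g : SemiRiemannianMetric E' N}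
    {nabla : CovariantDerivative 𝓘(ℝ, E') E' (TangentSpace 𝓘(ℝ, E') : N → Type _)}
    (hn : IsLeviCivita g nabla) {f : M → N} (hf : ContMDiff 𝓘(ℝ, E) 𝓘(ℝ, E') ∞ f)
    {X Y : Π x : M, TangentSpace 𝓘(ℝ, E) x} {p : M} (hX : MDiffAt (T% X) p)
    (hY : MDiffAt (T% Y) p) :
    covAlong nabla f (fun x => mfderiv 𝓘(ℝ, E) 𝓘(ℝ, E') f x (Y x)) p (X p) -
        covAlong nabla f (fun x => mfderiv 𝓘(ℝ, E) 𝓘(ℝ, E') f x (X x)) p (Y p) =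
      mfderiv 𝓘(ℝ, E) 𝓘(ℝ, E') f p (mlieBracket 𝓘(ℝ, E) X Y p) := by
  have hy : f p ∈ (chartAt E' (f p)).source := mem_chart_source E' (f p)
  have hfd : MDifferentiable 𝓘(ℝ, E) 𝓘(ℝ, E') f := hf.mdifferentiable (by simp)
  -- The components of `df v` are the derivatives of the functions `xⁱ ∘ f`, so the derivative terms
  -- of the two sides match by the bracket formula.
  have hcoeff : ∀ (i : Fin (Module.finrank ℝ E')) {x : M} (_ : f x ∈ (chartAt E' (f p)).source)
      (v : TangentSpace 𝓘(ℝ, E) x),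
      coordCoeff (f p) i (f x) (mfderiv 𝓘(ℝ, E) 𝓘(ℝ, E') f x v) =
        mvfderiv 𝓘(ℝ, E) (coordFun (f p) i ∘ f) x v := by
    intro i x hx v
    rw [coordCoeff_eq_mvfderiv hx]
    exact (mvfderiv_comp_apply x ((contMDiffAt_coordFun hx i).mdifferentiableAt (by simp))
      (hfd x) v).symm
  have hev : ∀ (i : Fin (Module.finrank ℝ E')) (Z : Π x : M, TangentSpace 𝓘(ℝ, E) x),
      (fun x => coordCoeff (f p) i (f x) (mfderiv 𝓘(ℝ, E) 𝓘(ℝ, E') f x (Z x))) =ᶠ[𝓝 p]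
        fun x => mvfderiv 𝓘(ℝ, E) (coordFun (f p) i ∘ f) x (Z x) := by
    intro i Z
    filter_upwards [eventually_mem_chart_source (E' := E') (hfd p).continuousAt] with x hx
    exact hcoeff i hx (Z x)
  have hbr : ∀ i, coordCoeff (f p) i (f p)
      (mfderiv 𝓘(ℝ, E) 𝓘(ℝ, E') f p (mlieBracket 𝓘(ℝ, E) X Y p)) =
      mvfderiv 𝓘(ℝ, E) (fun x => coordCoeff (f p) i (f x)
        (mfderiv 𝓘(ℝ, E) 𝓘(ℝ, E') f x (Y x))) p (X p) -
      mvfderiv 𝓘(ℝ, E) (fun x => coordCoeff (f p) i (f x)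
        (mfderiv 𝓘(ℝ, E) 𝓘(ℝ, E') f x (X x))) p (Y p) := by
    intro i
    have hφ : ContMDiffAt 𝓘(ℝ, E) 𝓘(ℝ, ℝ) 2 (coordFun (f p) i ∘ f) p :=
      ((contMDiffAt_coordFun hy i).comp p (hf p)).of_le (by norm_cast)
    rw [hcoeff i hy, mvfderiv_congr (hev i Y), mvfderiv_congr (hev i X),
      mvfderiv_mlieBracket hφ hX hY]
  -- The Christoffel terms are symmetric: coordinate fields commute, so vanishing torsion gives
  -- `∇_{∂ⱼ}∂ᵢ = ∇_{∂ᵢ}∂ⱼ`.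
  have hcross : ∀ u w : TangentSpace 𝓘(ℝ, E') (f p),
      ∑ i, coordCoeff (f p) i (f p) u • nabla (coordField (f p) i) (f p) w =
        ∑ i, coordCoeff (f p) i (f p) w • nabla (coordField (f p) i) (f p) u := by
    intro u w
    have h : ∀ a b : TangentSpace 𝓘(ℝ, E') (f p),
        ∑ i, coordCoeff (f p) i (f p) a • nabla (coordField (f p) i) (f p) b =
        ∑ i, ∑ j, (coordCoeff (f p) i (f p) a * coordCoeff (f p) j (f p) b) •
          nabla (coordField (f p) i) (f p) (coordField (f p) j (f p)) := by
      intro a b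
      refine Finset.sum_congr rfl fun i _ => ?_
      conv_lhs => rw [← sum_coordCoeff_smul hy b]
      simp [Finset.smul_sum, smul_smul]
    rw [h, h, Finset.sum_comm]
    refine Finset.sum_congr rfl fun i _ => Finset.sum_congr rfl fun j _ => ?_
    have ht := hn.torsion_free (coordField (f p) i) (coordField (f p) j) (f p)
      (mdifferentiableAt_coordField hy i) (mdifferentiableAt_coordField hy j)
    rw [mlieBracket_coordField hy, sub_eq_zero] at ht
    rw [ht, mul_comm]
  rw [← sum_coordCoeff_smul hy (mfderiv 𝓘(ℝ, E) 𝓘(ℝ, E') f p (mlieBracket 𝓘(ℝ, E) X Y p)),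
    covAlong_def, covAlong_def, Finset.sum_add_distrib, Finset.sum_add_distrib,
    hcross (mfderiv 𝓘(ℝ, E) 𝓘(ℝ, E') f p (Y p)), add_sub_add_right_eq_sub,
    ← Finset.sum_sub_distrib]
  refine Finset.sum_congr rfl fun i _ => ?_
  rw [hbr i, sub_smul]

end Submanifold

/-! ### The pointwise criterion for membership in `D`. -/

/-- In a space `T ⊕ L ⊕ A` with `T = D + D' + D₂`, `J D ⊆ T`, `J D' ⊆ L₁ + S₀`, `J D₂ ⊆ A`, the
components of `J w` in `A` and `L` detect whether `w ∈ T` lies in `D`. -/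
theorem mem_iff_projection_mem {V : Type*} [AddCommGroup V] [Module ℝ V]
    {T A L L₁ L₂ S₀ D D' D₂ : Submodule ℝ V} {J : V →ₗ[ℝ] V} (hJ : Function.Injective J)
    (hL : IsCompl L (T ⊔ A)) (hA : IsCompl A (T ⊔ L)) (hT : D ⊔ D' ⊔ D₂ = T)
    (hD : D.map J ≤ T) (hD' : D'.map J ≤ L₁ ⊔ S₀) (hD₂ : D₂.map J ≤ A) (hL₁ : L₁ ≤ L)
    (hL₂ : L₂ ≤ L) (hS₀ : S₀ ≤ A) (hL₁L₂ : Disjoint L₁ L₂) {w : V} (hw : w ∈ T) :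
    w ∈ D ↔ A.projection (T ⊔ L) hA (J w) ∈ L₂.map J ∧ L.projection (T ⊔ A) hL (J w) ∈ L₂ := by
  constructor
  · intro hwD
    have h : J w ∈ T := hD (Submodule.mem_map_of_mem hwD)
    rw [(Submodule.projection_apply_eq_zero_iff hA).2 (Submodule.mem_sup_left h),
      (Submodule.projection_apply_eq_zero_iff hL).2 (Submodule.mem_sup_left h)]
    exact ⟨zero_mem _, zero_mem _⟩
  · rintro ⟨hwA, hwL⟩
    rw [← hT] at hw
    obtain ⟨x, hx, d₂, hd₂, rfl⟩ := Submodule.mem_sup.1 hw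
    obtain ⟨d, hd, d', hd', rfl⟩ := Submodule.mem_sup.1 hx
    have hTJ : J d ∈ T := hD (Submodule.mem_map_of_mem hd)
    have hAJ : J d₂ ∈ A := hD₂ (Submodule.mem_map_of_mem hd₂)
    obtain ⟨l, hl, s, hs, hls⟩ := Submodule.mem_sup.1 (hD' (Submodule.mem_map_of_mem hd'))
    have hsA : s + J d₂ ∈ A := A.add_mem (hS₀ hs) hAJ
    have hJw : J (d + d' + d₂) = J d + l + (s + J d₂) := by
      rw [map_add, map_add, ← hls]
      abel
    -- The `L`-component of `J w` is `l`, and `L₁` meets `L₂` trivially.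
    have hl0 : l = 0 := by
      have h : L.projection (T ⊔ A) hL (J (d + d' + d₂)) = l := by
        rw [hJw, show J d + l + (s + J d₂) = l + (J d + (s + J d₂)) by abel, map_add,
          (Submodule.projection_apply_eq_zero_iff hL).2 (Submodule.add_mem_sup hTJ hsA), add_zero]
        exact Submodule.projection_apply_of_mem_left hL (hL₁ hl)
      rw [h] at hwL
      exact Submodule.disjoint_def.1 hL₁L₂ l hl hwL
    have hA' : A.projection (T ⊔ L) hA (J (d + d' + d₂)) = J (d' + d₂) := by
      rw [hJw, map_add, (Submodule.projection_apply_eq_zero_iff hA).2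
        (Submodule.add_mem_sup hTJ (hL₁ hl)), zero_add, map_add J, ← hls, hl0, zero_add]
      exact Submodule.projection_apply_of_mem_left hA hsA
    rw [hA'] at hwA
    obtain ⟨u, hu, huJ⟩ := hwA
    have huT : d' + d₂ ∈ T := by
      rw [← hT]
      exact Submodule.add_mem_sup (Submodule.mem_sup_right hd') hd₂
    -- Injectivity of `J` puts this tangent vector in `L₂ ≤ L`, which meets `T` trivially.
    have h0 : d' + d₂ = 0 := Submodule.disjoint_def.1 hL.disjoint _
      (hJ huJ ▸ hL₂ hu) (Submodule.mem_sup_left huT)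
    rw [add_assoc, h0, add_zero]
    exact hd

/-! ### Smoothness of brackets of sections. -/

section Sections

variable {E' : Type*} [NormedAddCommGroup E'] [NormedSpace ℝ E']
  {N : Type*} [TopologicalSpace N] [ChartedSpace E' N]
  {E : Type*} [NormedAddCommGroup E] [NormedSpace ℝ E]
  {M : Type*} [TopologicalSpace M] [ChartedSpace E M] [IsManifold 𝓘(ℝ, E) ∞ M] {f : M → N}
  {F : Π p : M, Submodule ℝ (TangentSpace 𝓘(ℝ, E') (f p))}

theorem IsSectionOf.mdifferentiableAt
    {X : Π p : M, TangentSpace 𝓘(ℝ, E) p} (hX : IsSectionOf f F X) (p : M) :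
    MDiffAt (T% X) p :=
  hX.1.mdifferentiable (by simp) p

theorem IsSectionOf.contMDiff_mlieBracket [CompleteSpace E]
    {X Y : Π p : M, TangentSpace 𝓘(ℝ, E) p} (hX : IsSectionOf f F X) (hY : IsSectionOf f F Y) :
    ContMDiff 𝓘(ℝ, E) 𝓘(ℝ, E).tangent ∞ (T% (mlieBracket 𝓘(ℝ, E) X Y)) :=
  -- The bracket costs one derivative, which is harmless at order `∞`, where `∞ + 1 = ∞`; over `ℝ`,
  -- `minSmoothness` adds no requirement.
  have : IsManifold 𝓘(ℝ, E) (((⊤ : ℕ∞) : ℕ∞ω) + 1) M := inferInstanceAs (IsManifold 𝓘(ℝ, E) ∞ M)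
  have : IsManifold 𝓘(ℝ, E) (minSmoothness ℝ 2) M := by
    rw [minSmoothness_of_isRCLikeNormedField]
    infer_instance
  ContDiff.mlieBracket_vectorField (m := ⊤) (n := ⊤) hX.1 hY.1 (by simp)

end Sections

/-! ### The STCR decomposition and the identity for `J[X, Y]`. -/

section Submanifold

variable {E' : Type*} [NormedAddCommGroup E'] [NormedSpace ℝ E']
  {N : Type*} [TopologicalSpace N] [ChartedSpace E' N] [IsManifold 𝓘(ℝ, E') ∞ N]
  {E : Type*} [NormedAddCommGroup E] [NormedSpace ℝ E]
  {M : Type*} [TopologicalSpace M] [ChartedSpace E M]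
  {q : ℕ} {K : IndefiniteKahler E' N q} {f : M → N} {r : ℕ}
  {S : LightlikeSubmanifold (E := E) K.g f r}

theorem IndefiniteKahler.J_injective (K : IndefiniteKahler E' N q) (x : N) :
    Function.Injective (K.J x) := fun u v h => by
  have h2 := congrArg (K.J x) h
  rwa [K.J_sq, K.J_sq, neg_inj] at h2

namespace STCRStructure

variable (C : STCRStructure K S)

theorem JImage_JImage_D₁_le (p : M) : JImage K f (JImage K f C.D₁) p ≤ C.D₁ p := by
  rintro _ ⟨_, ⟨u, hu, rfl⟩, rfl⟩
  exact (K.J_sq (f p) u).symm ▸ (C.D₁ p).neg_mem hu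

/-- The distribution `D` is `J`-invariant. -/
theorem map_J_D_le (p : M) : (C.D p).map (K.J (f p)).toLinearMap ≤ C.D p := by
  have h₀ : (C.D₀ p).map (K.J (f p)).toLinearMap ≤ C.D p :=
    (C.JD₀_eq p).le.trans (le_sup_left.trans le_sup_left)
  have h₁ : (C.D₁ p).map (K.J (f p)).toLinearMap ≤ C.D p := le_sup_right
  have h₂ : (JImage K f C.D₁ p).map (K.J (f p)).toLinearMap ≤ C.D p :=
    (C.JImage_JImage_D₁_le p).trans (le_sup_right.trans le_sup_left)
  unfold D
  rw [Submodule.map_sup, Submodule.map_sup]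
  exact sup_le (sup_le h₀ h₁) h₂

/-- The summands of `S(TM)` and `Rad TM` are regrouped. The criterion needs only that they span, not
that the sum is direct. -/
theorem D_sup_D'_sup_D₂ (p : M) :
    C.D p ⊔ C.D' p ⊔ C.D₂ p = tangent (E := E) f p := by
  rw [← S.screen_sup p, ← C.D₁_D₂_sup p, ← C.JD₁_D'_D₀_sup p]
  unfold D
  ac_rfl

variable [FiniteDimensional ℝ E']

/-- A tangent vector `w` lies in `D` if and only if the `S(TM^⊥)`- and `ltr(TM)`-components of
`J w` lie in `J L₂` and `L₂`. -/
theorem mem_D_iff {L₂ : Π p : M, Submodule ℝ (TangentSpace 𝓘(ℝ, E') (f p))} {p : M}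
    (hdisj : Disjoint (C.L₁ p) (L₂ p)) (hsup : C.L₁ p ⊔ L₂ p = S.ltr p)
    {w : TangentSpace 𝓘(ℝ, E') (f p)} (hw : w ∈ tangent (E := E) f p) :
    w ∈ C.D p ↔ S.coscreenPart p (K.J (f p) w) ∈ JImage K f L₂ p ∧
      S.ltrPart p (K.J (f p) w) ∈ L₂ p :=
  mem_iff_projection_mem (J := (K.J (f p)).toLinearMap) (K.J_injective (f p)) (S.splitting p).1
    (S.splitting p).2 (C.D_sup_D'_sup_D₂ p)
    ((C.map_J_D_le p).trans
      ((le_sup_left.trans le_sup_left).trans (C.D_sup_D'_sup_D₂ p).le))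
    (C.JD'_eq p).le (C.JD₂_le p) (C.L₁_le p) (hsup ▸ le_sup_right) (C.S₀_le p) hdisj hw

end STCRStructure

variable [FiniteDimensional ℝ E']

/-- `∇_X JY - ∇_Y JX = J df [X, Y]`. -/
theorem covAlong_JField_sub [IsManifold 𝓘(ℝ, E) ∞ M] [CompleteSpace E]
    (K : IndefiniteKahler E' N q) (hf : ContMDiff 𝓘(ℝ, E) 𝓘(ℝ, E') ∞ f)
    {X Y : Π x : M, TangentSpace 𝓘(ℝ, E) x} {p : M} (hX : MDiffAt (T% X) p)
    (hY : MDiffAt (T% Y) p) :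
    covAlong K.nabla f (JField K f Y) p (X p) - covAlong K.nabla f (JField K f X) p (Y p) =
      K.J (f p) (mfderiv 𝓘(ℝ, E) 𝓘(ℝ, E') f p (mlieBracket 𝓘(ℝ, E) X Y p)) := by
  have hfp := hf.mdifferentiable (by simp) p
  rw [← covAlong_torsion_free K.leviCivita hf hX hY, map_sub,
    ← covAlong_J K hfp (mdifferentiableAt_mfderiv_apply hf hX),
    ← covAlong_J K hfp (mdifferentiableAt_mfderiv_apply hf hY)]
  rfl

end Submanifold

end STCR

/-! ### The integrability theorem. -/

theorem theorem3p4
    {E' : Type*} [NormedAddCommGroup E'] [NormedSpace ℝ E'] [FiniteDimensional ℝ E']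
    {N : Type*} [TopologicalSpace N] [T2Space N] [SecondCountableTopology N]
    [ChartedSpace E' N] [IsManifold 𝓘(ℝ, E') ∞ N]
    {E : Type*} [NormedAddCommGroup E] [NormedSpace ℝ E] [FiniteDimensional ℝ E]
    {M : Type*} [TopologicalSpace M] [T2Space M] [SecondCountableTopology M]
    [ChartedSpace E M] [IsManifold 𝓘(ℝ, E) ∞ M]
    {q : ℕ} (K : STCR.IndefiniteKahler E' N q)
    {f : M → N} {r : ℕ} (S : STCR.LightlikeSubmanifold (E := E) K.g f r)
    (C : STCR.STCRStructure K S)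
    (L₂ : Π p : M, Submodule ℝ (TangentSpace 𝓘(ℝ, E') (f p)))
    (hL₂ : STCR.IsSubbundle (E := E) f L₂)
    (hL₁L₂_disjoint : ∀ p, Disjoint (C.L₁ p) (L₂ p))
    (hL₁L₂_sup : ∀ p, C.L₁ p ⊔ L₂ p = S.ltr p) :
    STCR.IsIntegrable (E := E) f C.D ↔
      ∀ X Y : Π p : M, TangentSpace 𝓘(ℝ, E) p,
        STCR.IsSectionOf f C.D X → STCR.IsSectionOf f C.D Y →
          (∀ p, STCR.hs K S X (STCR.JField K f Y) p - STCR.hs K S Y (STCR.JField K f X) p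
              ∈ STCR.JImage K f L₂ p) ∧
          (∀ p, STCR.hl K S X (STCR.JField K f Y) p - STCR.hl K S Y (STCR.JField K f X) p
              ∈ L₂ p) := by
  have : CompleteSpace E := FiniteDimensional.complete ℝ E
  -- The equivalence holds at each point and for each pair of sections; integrability adds only the
  -- smoothness of the bracket, which is automatic.
  have key : ∀ X Y : Π p : M, TangentSpace 𝓘(ℝ, E) p,
      STCR.IsSectionOf f C.D X → STCR.IsSectionOf f C.D Y → ∀ p,
      (mfderiv 𝓘(ℝ, E) 𝓘(ℝ, E') f p (VectorField.mlieBracket 𝓘(ℝ, E) X Y p) ∈ C.D p ↔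
        STCR.hs K S X (STCR.JField K f Y) p - STCR.hs K S Y (STCR.JField K f X) p
            ∈ STCR.JImage K f L₂ p ∧
          STCR.hl K S X (STCR.JField K f Y) p - STCR.hl K S Y (STCR.JField K f X) p
            ∈ L₂ p) := by
    intro X Y hX hY p
    refine (C.mem_D_iff (hL₁L₂_disjoint p) (hL₁L₂_sup p) ⟨_, rfl⟩).trans ?_
    rw [ContinuousLinearMap.coe_coe,
      ← STCR.covAlong_JField_sub K S.immersed.contMDiff (hX.mdifferentiableAt p)
        (hY.mdifferentiableAt p), map_sub, map_sub]
    rfl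
  constructor
  · intro h X Y hX hY
    exact ⟨fun p => ((key X Y hX hY p).1 ((h X Y hX hY).2 p)).1,
      fun p => ((key X Y hX hY p).1 ((h X Y hX hY).2 p)).2⟩
  · intro h X Y hX hY
    exact ⟨hX.contMDiff_mlieBracket hY,
      fun p => (key X Y hX hY p).2 ⟨(h X Y hX hY).1 p, (h X Y hX hY).2 p⟩⟩
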